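/- Let $n\ge 2$ and $m\ge 0$ be integers. Equip $(\mathbb C^n)^{\otimes m}$ with the hermitian form determined by $\langle v_1\otimes\cdots\otimes v_m,\,w_1\otimes\cdots\otimes w_m\rangle=\prod_{i=1}^m\langle v_i,w_i\rangle$, and put $\|T\|=\sqrt{\langle T,T\rangle}$. A pure tensor is one of the form $v_1\otimes\cdots\otimes v_m$. The spectral norm $\|T\|_\sigma$ of $T\in(\mathbb C^n)^{\otimes m}$ is the maximum of $|\langle T,u\rangle|$ over all pure tensors $u$ with $\|u\|=1$, and the entanglement of a tensor $T$ with $\|T\|=1$ is $E(T)=-2\log_2\|T\|_\sigma$. Let $\mathrm S^m_1(\mathbb C^n)$ be the set of tensors $T\in(\mathbb C^n)^{\otimes m}$ with $\|T\|=1$ that are symmetric, i.e. invariant under all permutations of the $m$ tensor factors, and let $d_{n,m}=\binom{m+n-1}{m}$. Fix $n\ge 2$. For every $m$ the maximum $E^s_{\max}=\max\{E(T) : T\in \mathrm S^m_1(\mathbb C^n)\}$ exists, and there is $m_0=m_0(n)$ such that for all $m\ge m_0$ $$E^s_{\max}\;\ge\;\log_2(d_{n,m})-\log_2(\ln d_{n,m})-\log_2(n).$$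 -/

import Mathlib

open scoped TensorProduct

noncomputable section

namespace SymEntanglement

/-- The tensor space `(ℂ^n)^{⊗ m}`, where `ℂ^n` carries its standard hermitian form. -/
abbrev Tensor (n m : ℕ) : Type :=
  ⨂[ℂ]^m (EuclideanSpace ℂ (Fin n))

/-- The basis `e_{p 0} ⊗ ⋯ ⊗ e_{p (m-1)}` of `(ℂ^n)^{⊗ m}`, indexed by `p : Fin m → Fin n`. -/
def stdBasis (n m : ℕ) : Module.Basis (Fin m → Fin n) ℂ (Tensor n m) :=
  Basis.piTensorProduct fun _ => (EuclideanSpace.basisFun (Fin n) ℂ).toBasis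

/-- The hermitian form on `(ℂ^n)^{⊗ m}` that makes the basis `stdBasis` orthonormal (linear in the
second argument).  By `tensorInner_tprod` and sesquilinearity it is the form determined by
`⟨v₁ ⊗ ⋯ ⊗ v_m, w₁ ⊗ ⋯ ⊗ w_m⟩ = ∏ i, ⟨v_i, w_i⟩`. -/
def tensorInner {n m : ℕ} (S T : Tensor n m) : ℂ :=
  ∑ p : Fin m → Fin n, starRingEnd ℂ ((stdBasis n m).repr S p) * (stdBasis n m).repr T p

/-- The euclidean (Hilbert space) norm `‖T‖ = √⟨T, T⟩`.  (This is not the norm instance which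
Mathlib puts on a `PiTensorProduct`; that one is the projective seminorm and is not used.) -/
def tensorNorm {n m : ℕ} (T : Tensor n m) : ℝ :=
  Real.sqrt (tensorInner T T).re

/-- `u` is a pure tensor: `u = v₁ ⊗ ⋯ ⊗ v_m` for some vectors `v_i` of `ℂ^n`. -/
def IsPure {n m : ℕ} (u : Tensor n m) : Prop :=
  ∃ v : Fin m → EuclideanSpace ℂ (Fin n), u = PiTensorProduct.tprod ℂ v

/-- The spectral norm: the maximal value of `|⟨T, u⟩|` over all pure tensors `u` with `‖u‖ = 1`
(see `isGreatest_spectralNorm`). -/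
def spectralNorm {n m : ℕ} (T : Tensor n m) : ℝ :=
  sSup {x : ℝ | ∃ u : Tensor n m, IsPure u ∧ tensorNorm u = 1 ∧ x = ‖tensorInner T u‖}

/-- The geometric measure of entanglement `E(T) = -2 log₂ ‖T‖_σ` (of a unit tensor `T`). -/
def entanglement {n m : ℕ} (T : Tensor n m) : ℝ :=
  -2 * Real.logb 2 (spectralNorm T)

/-- `T` is a symmetric tensor: it is invariant under all permutations of the tensor factors. -/
def IsSymmetric {n m : ℕ} (T : Tensor n m) : Prop :=
  ∀ σ : Equiv.Perm (Fin m),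
    PiTensorProduct.reindex ℂ (fun _ : Fin m => EuclideanSpace ℂ (Fin n)) σ T = T

/-- The set of symmetric tensors of euclidean norm `1` in `(ℂ^n)^{⊗ m}`. -/
def unitSymmetric (n m : ℕ) : Set (Tensor n m) :=
  {T | IsSymmetric T ∧ tensorNorm T = 1}

/-- The supremum of `E(T)` over all unit symmetric tensors `T` in `(ℂ^n)^{⊗ m}`; the theorem also
says that it is a maximum. -/
def maxSymEntanglement (n m : ℕ) : ℝ :=
  sSup (entanglement '' unitSymmetric n m)

/-- The number `d_{n,m} = (m + n - 1 choose m)`, used for `n ≥ 1` only. -/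
def symDim (n m : ℕ) : ℕ :=
  (m + n - 1).choose m

/-- Coordinates of a pure tensor. -/
theorem stdBasis_repr_tprod {n m : ℕ} (v : Fin m → EuclideanSpace ℂ (Fin n))
    (p : Fin m → Fin n) :
    (stdBasis n m).repr (PiTensorProduct.tprod ℂ v) p = ∏ i, v i (p i) := by
  simp [stdBasis]

/-- The defining property of the hermitian form on the tensor product. -/
theorem tensorInner_tprod {n m : ℕ} (v w : Fin m → EuclideanSpace ℂ (Fin n)) :
    tensorInner (PiTensorProduct.tprod ℂ v) (PiTensorProduct.tprod ℂ w) =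
      ∏ i, inner ℂ (v i) (w i) := by
  simp only [tensorInner, stdBasis_repr_tprod, map_prod, ← Finset.prod_mul_distrib,
    PiLp.inner_apply, RCLike.inner_apply]
  rw [Finset.prod_univ_sum]
  simp [mul_comm]

/-- The norm of a pure tensor. -/
theorem tensorNorm_tprod {n m : ℕ} (v : Fin m → EuclideanSpace ℂ (Fin n)) :
    tensorNorm (PiTensorProduct.tprod ℂ v) = ∏ i, ‖v i‖ := by
  have h : (∏ i, inner ℂ (v i) (v i) : ℂ) = (((∏ i, ‖v i‖) ^ 2 : ℝ) : ℂ) := by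
    rw [← Finset.prod_pow]
    push_cast
    exact Finset.prod_congr rfl fun i _ => inner_self_eq_norm_sq_to_K (v i)
  rw [tensorNorm, tensorInner_tprod, h, Complex.ofReal_re,
    Real.sqrt_sq (Finset.prod_nonneg fun i _ => norm_nonneg _)]

/-- A pure unit tensor is a tensor product of unit vectors. -/
theorem exists_unit_factors {n m : ℕ} {u : Tensor n m} (hu : IsPure u) (h1 : tensorNorm u = 1) :
    ∃ v : Fin m → EuclideanSpace ℂ (Fin n),
      (∀ i, ‖v i‖ = 1) ∧ u = PiTensorProduct.tprod ℂ v := by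
  obtain ⟨v, rfl⟩ := hu
  rw [tensorNorm_tprod] at h1
  have h0 : ∀ i, ‖v i‖ ≠ 0 := fun i h => by
    rw [Finset.prod_eq_zero (Finset.mem_univ i) h] at h1
    exact zero_ne_one h1
  refine ⟨fun i => ((‖v i‖ : ℂ)⁻¹) • v i, fun i => ?_, ?_⟩
  · rw [norm_smul, norm_inv, Complex.norm_real, norm_norm, inv_mul_cancel₀ (h0 i)]
  · rw [MultilinearMap.map_smul_univ, Finset.prod_inv_distrib, ← Complex.ofReal_prod, h1]
    simp

/-- The maximum in the definition of the spectral norm exists. -/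
theorem isGreatest_spectralNorm {n m : ℕ} (hn : 1 ≤ n) (T : Tensor n m) :
    IsGreatest {x : ℝ | ∃ u : Tensor n m, IsPure u ∧ tensorNorm u = 1 ∧ x = ‖tensorInner T u‖}
      (spectralNorm T) := by
  let f : (Fin m → EuclideanSpace ℂ (Fin n)) → ℝ := fun v =>
    ‖tensorInner T (PiTensorProduct.tprod ℂ v)‖
  have hf : Continuous f := by
    simp only [f, tensorInner, stdBasis_repr_tprod]
    fun_prop
  let K : Set (Fin m → EuclideanSpace ℂ (Fin n)) := Set.univ.pi fun _ => Metric.sphere 0 1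
  have hK : IsCompact K := isCompact_univ_pi fun _ => isCompact_sphere 0 1
  have hKne : K.Nonempty :=
    ⟨fun _ => EuclideanSpace.single ⟨0, hn⟩ 1, fun i _ => by simp⟩
  have hset : {x : ℝ | ∃ u : Tensor n m, IsPure u ∧ tensorNorm u = 1 ∧ x = ‖tensorInner T u‖}
      = f '' K := by
    ext x
    constructor
    · rintro ⟨u, hu, h1, rfl⟩
      obtain ⟨v, hv, rfl⟩ := exists_unit_factors hu h1
      exact ⟨v, fun i _ => by simp [hv i], rfl⟩
    · rintro ⟨v, hv, rfl⟩
      refine ⟨_, ⟨v, rfl⟩, ?_, rfl⟩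
      rw [tensorNorm_tprod]
      exact Finset.prod_eq_one fun i _ => by simpa using hv i (Set.mem_univ i)
  rw [spectralNorm, hset]
  exact (hK.image hf).isGreatest_sSup (hKne.image f)

end SymEntanglement

end

/-! The extremal tensor is found by the probabilistic method. A symmetric tensor `T` is a
homogeneous polynomial of degree `m`. By Banach's theorem (`norm_multilinear_le_of_diagonal`) its
spectral norm is already approached on powers `w ⊗ ⋯ ⊗ w`, so it is enough to bound that polynomial
on the unit sphere.

Let `P = ∑ ε_s √c_s z^s` over all monomials of degree `m`, with `c_s` the multinomial coefficients
and `ε_s` phases; `P / √d` comes from a unit tensor, where `d = symDim n m`. Collect `P ^ k` by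
monomials `z^b` of degree `k * m`, and apply Cauchy-Schwarz with weights `C_b` for which `∑ C_b
|z^b|² = 1` on the sphere. This bounds `|P| ^ (2k)` by a sum over `b` that does not depend on the
point. Over random phases each summand has mean at most `k!`, since a phase monomial of degree `k`
matches at most `k!` rearrangements of itself. So one choice of phases gives `|P| ^ (2k) ≤ k! *
symDim n (k * m)` on the whole sphere (`exists_phases_norm_pow_le`), without any net argument.

With `k = ⌈ln d⌉` one has `symDim n (k * m) ≤ k ^ (n - 1) * d` and `d ≤ e ^ k`, and Stirling-type
bounds make the right side at most `(n ln d) ^ k` for large `m`. Thus `‖T‖_σ² ≤ n ln d / d`. -/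

/-! ### Second moments of random phase polynomials -/

open Finset in
/-- The sum over all phases of a quotient of two phase monomials of degree `k` vanishes unless the
monomials agree up to a permutation of their factors. -/
theorem norm_sum_stdAddChar_le {A : Type*} [Fintype A] [DecidableEq A] (k : ℕ) (s t : Fin k → A) :
    ‖∑ e : A → ZMod (k + 1), ZMod.stdAddChar (∑ j, e (s j) - ∑ j, e (t j))‖ ≤
      (Fintype.card (A → ZMod (k + 1)) : ℝ) *
        ∑ σ : Equiv.Perm (Fin k), if t = s ∘ σ then (1 : ℝ) else 0 := by
  let φ : (A → ZMod (k + 1)) →+ ZMod (k + 1) :=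
    { toFun := fun e => ∑ j, e (s j) - ∑ j, e (t j)
      map_zero' := by simp
      map_add' := fun x y => by simp [sum_add_distrib]; ring }
  -- The summand is a character of the group of phase choices: its sum vanishes unless it is
  -- trivial.
  let χ : AddChar (A → ZMod (k + 1)) ℂ := (ZMod.stdAddChar (N := k + 1)).compAddMonoidHom φ
  have hnonneg : (0 : ℝ) ≤ ∑ σ : Equiv.Perm (Fin k), if t = s ∘ σ then (1 : ℝ) else 0 :=
    sum_nonneg fun σ _ => by split_ifs <;> norm_num
  by_cases hχ : χ = 1
  · have hcount : ∀ a, #{j | t j = a} = #{j | s j = a} := fun a => by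
      have h1 : ZMod.stdAddChar (φ (Pi.single a 1)) = 1 := by
        have := congrArg (fun ψ : AddChar _ ℂ => ψ (Pi.single a 1)) hχ
        simpa [χ] using this
      have h2 : φ (Pi.single a 1) = 0 :=
        ZMod.injective_stdAddChar (h1.trans (AddChar.map_zero_eq_one _).symm)
      have h3 : ((#{j | t j = a} : ℕ) : ZMod (k + 1)) = (#{j | s j = a} : ℕ) := by
        have h4 : ∑ j, Pi.single (M := fun _ => ZMod (k + 1)) a 1 (s j) -
            ∑ j, Pi.single (M := fun _ => ZMod (k + 1)) a 1 (t j) = 0 := h2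
        simp only [Pi.single_apply, sum_boole, sub_eq_zero] at h4
        exact h4.symm
      -- Multiplicities are at most `k`, so residues mod `k + 1` determine them; this dictates the
      -- order of the roots of unity.
      have hlt : ∀ u : Fin k → A, #{j | u j = a} < k + 1 := fun u =>
        Nat.lt_succ_of_le ((card_le_univ _).trans_eq (by simp))
      rw [ZMod.natCast_eq_natCast_iff'] at h3
      rwa [Nat.mod_eq_of_lt (hlt t), Nat.mod_eq_of_lt (hlt s)] at h3
    have e : ∀ a, {j // t j = a} ≃ {j // s j = a} := fun a =>
      Fintype.equivOfCardEq (by rw [Fintype.card_subtype, Fintype.card_subtype, hcount])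
    have hperm : t = s ∘ Equiv.ofFiberEquiv e :=
      funext fun j => (Equiv.ofFiberEquiv_map e j).symm
    have h1 : (1 : ℝ) ≤ ∑ σ : Equiv.Perm (Fin k), if t = s ∘ σ then (1 : ℝ) else 0 := by
      refine le_trans ?_ (single_le_sum (f := fun σ : Equiv.Perm (Fin k) =>
        if t = s ∘ σ then (1 : ℝ) else 0) (fun σ _ => by positivity)
        (mem_univ (Equiv.ofFiberEquiv e)))
      simp [← hperm]
    calc _ ≤ ∑ e : A → ZMod (k + 1), ‖ZMod.stdAddChar (∑ j, e (s j) - ∑ j, e (t j))‖ :=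
          norm_sum_le _ _
      _ = (Fintype.card (A → ZMod (k + 1)) : ℝ) * 1 := by
          simp only [ZMod.stdAddChar_apply, Circle.norm_coe, sum_const, card_univ, nsmul_eq_mul]
      _ ≤ _ := by gcongr
  · have : ∑ e, χ e = 0 := AddChar.sum_eq_zero_of_ne_one hχ
    have h0 : ∑ e : A → ZMod (k + 1), ZMod.stdAddChar (∑ j, e (s j) - ∑ j, e (t j)) = 0 := this
    rw [h0, norm_zero]
    positivity

open Finset in
/-- The second moment of a homogeneous polynomial of degree `k` in independent random phases. -/
theorem sum_norm_sq_phase_le {A : Type*} [Fintype A] [DecidableEq A] (k : ℕ)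
    (S : Finset (Fin k → A)) (w : A → ℝ) (hw : ∀ a, 0 ≤ w a) :
    ∑ e : A → ZMod (k + 1),
        ‖∑ s ∈ S, ∏ j, (ZMod.stdAddChar (e (s j)) * (w (s j) : ℂ))‖ ^ 2 ≤
      (Fintype.card (A → ZMod (k + 1)) : ℝ) * (k.factorial * ∑ s ∈ S, ∏ j, w (s j) ^ 2) := by
  set W : (Fin k → A) → ℝ := fun s => ∏ j, w (s j) with hW
  have hW0 : ∀ s, 0 ≤ W s := fun s => prod_nonneg fun j _ => hw _
  have hcomp : ∀ (s : Fin k → A) (σ : Equiv.Perm (Fin k)), W (s ∘ σ) = W s := fun s σ =>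
    Equiv.prod_comp σ fun j => w (s j)
  have hterm : ∀ (e : A → ZMod (k + 1)) (s : Fin k → A),
      ∏ j, (ZMod.stdAddChar (e (s j)) * (w (s j) : ℂ)) =
        ZMod.stdAddChar (∑ j, e (s j)) * (W s : ℂ) := fun e s => by
    have h := map_sum (ZMod.stdAddChar (N := k + 1)).toAddMonoidHom (fun j => e (s j)) univ
    have h' : ZMod.stdAddChar (∑ j, e (s j)) = ∏ j, ZMod.stdAddChar (e (s j)) := h
    rw [prod_mul_distrib, h']
    simp [hW]
  have hconj : ∀ x : ZMod (k + 1), starRingEnd ℂ (ZMod.stdAddChar x) = ZMod.stdAddChar (-x) :=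
    fun x => (AddChar.map_neg_eq_conj _ x).symm
  have hexp : ((∑ e : A → ZMod (k + 1),
        ‖∑ s ∈ S, ∏ j, (ZMod.stdAddChar (e (s j)) * (w (s j) : ℂ))‖ ^ 2 : ℝ) : ℂ) =
      ∑ s ∈ S, ∑ t ∈ S, (W s * W t : ℝ) *
        ∑ e : A → ZMod (k + 1), ZMod.stdAddChar (∑ j, e (s j) - ∑ j, e (t j)) := by
    push_cast
    simp_rw [← Complex.mul_conj', hterm, map_sum, sum_mul_sum, map_mul, hconj, Complex.conj_ofReal]
    rw [sum_comm]
    refine sum_congr rfl fun s _ => ?_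
    rw [sum_comm]
    refine sum_congr rfl fun t _ => ?_
    rw [mul_sum]
    refine sum_congr rfl fun e _ => ?_
    rw [sub_eq_add_neg, AddChar.map_add_eq_mul]
    ring
  -- Each of the `k!` permutations contributes at most one `t`, and then `W t = W s`.
  have hle : ∀ s : Fin k → A, ∑ t ∈ S, W s * W t *
      (∑ σ : Equiv.Perm (Fin k), if t = s ∘ σ then (1 : ℝ) else 0) ≤ k.factorial * W s ^ 2 := by
    intro s
    calc _ = ∑ σ : Equiv.Perm (Fin k), ∑ t ∈ S, if t = s ∘ σ then W s * W t else 0 := by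
          rw [sum_comm]
          simp_rw [mul_sum, mul_ite, mul_one, mul_zero]
      _ ≤ ∑ _σ : Equiv.Perm (Fin k), W s ^ 2 := by
          refine sum_le_sum fun σ _ => ?_
          rw [sum_ite_eq']
          split_ifs
          · rw [hcomp, sq]
          · positivity
      _ = _ := by simp [Fintype.card_perm]
  set N : ℝ := (Fintype.card (A → ZMod (k + 1)) : ℝ) with hN
  rw [← Real.norm_of_nonneg (sum_nonneg fun e _ => by positivity :
    (0 : ℝ) ≤ ∑ e : A → ZMod (k + 1),
      ‖∑ s ∈ S, ∏ j, (ZMod.stdAddChar (e (s j)) * (w (s j) : ℂ))‖ ^ 2), ← Complex.norm_real, hexp]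
  calc _ ≤ ∑ s ∈ S, ∑ t ∈ S, W s * W t * (N *
        ∑ σ : Equiv.Perm (Fin k), if t = s ∘ σ then (1 : ℝ) else 0) := by
        refine norm_sum_le_of_le _ fun s _ => norm_sum_le_of_le _ fun t _ => ?_
        rw [norm_mul, Complex.norm_real, Real.norm_of_nonneg (mul_nonneg (hW0 s) (hW0 t))]
        exact mul_le_mul_of_nonneg_left (norm_sum_stdAddChar_le k s t)
          (mul_nonneg (hW0 s) (hW0 t))
    _ = N * ∑ s ∈ S, ∑ t ∈ S, W s * W t *
        (∑ σ : Equiv.Perm (Fin k), if t = s ∘ σ then (1 : ℝ) else 0) := by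
        rw [mul_sum]
        refine sum_congr rfl fun s _ => ?_
        rw [mul_sum]
        exact sum_congr rfl fun t _ => by ring
    _ ≤ N * ∑ s ∈ S, (k.factorial * W s ^ 2) := by
        gcongr with s _
        exact hle s
    _ = _ := by simp_rw [← mul_sum, hW, prod_pow]

/-! ### Banach's theorem on symmetric multilinear forms -/

/-- A functional of norm at most `M` with value `M` at the unit vector `y` is `z ↦ M ⟪y, z⟫`. -/
theorem eq_mul_inner_of_norm_le {E : Type*} [NormedAddCommGroup E] [InnerProductSpace ℂ E]
    [FiniteDimensional ℂ E] (f : E →ₗ[ℂ] ℂ) {M : ℝ} {y : E} (hy : ‖y‖ = 1)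
    (hf : ∀ z, ‖f z‖ ≤ M * ‖z‖) (hfy : f y = M) (z : E) : f z = M * inner ℂ y z := by
  have : CompleteSpace E := FiniteDimensional.complete ℂ E
  set a : E := (InnerProductSpace.toDual ℂ E).symm (LinearMap.toContinuousLinearMap f) with ha
  have hfa : ∀ z, f z = inner ℂ a z := fun z => by simp [ha]
  have hM : 0 ≤ M := by simpa [hy] using (norm_nonneg _).trans (hf y)
  have hle : ‖a‖ ≤ M := by
    rw [ha, LinearIsometryEquiv.norm_map]
    exact ContinuousLinearMap.opNorm_le_bound _ hM fun z => hf z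
  -- Equality case of Cauchy-Schwarz: the expansion is `‖a‖² - 2M² + M²`, and `‖a‖ ≤ M`.
  have h0 : ‖a - (M : ℂ) • y‖ ^ 2 ≤ 0 := by
    rw [@norm_sub_sq ℂ, inner_smul_right, ← hfa, hfy, norm_smul, hy, Complex.norm_real,
      Real.norm_of_nonneg hM, ← Complex.ofReal_mul]
    have : RCLike.re ((M * M : ℝ) : ℂ) = M * M := Complex.ofReal_re _
    rw [this]
    nlinarith [norm_nonneg a]
  have h1 : a = (M : ℂ) • y := by
    rw [← sub_eq_zero, ← norm_eq_zero]
    exact pow_eq_zero_iff two_ne_zero |>.1 (le_antisymm h0 (sq_nonneg _))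
  rw [hfa, h1, inner_smul_left, Complex.conj_ofReal]

/-- If a symmetric bilinear form on a Hilbert space attains its norm at the pair of unit vectors
`x`, `y`, then it also attains it at the normalized sum of `x` and `y`. -/
theorem bilin_apply_add_self {E : Type*} [NormedAddCommGroup E] [InnerProductSpace ℂ E]
    [FiniteDimensional ℂ E] (B : E →ₗ[ℂ] E →ₗ[ℂ] ℂ) (hB : ∀ x y, B x y = B y x) {M : ℝ} {x y : E}
    (hx : ‖x‖ = 1) (hy : ‖y‖ = 1) (hle : ∀ x y, ‖B x y‖ ≤ M * (‖x‖ * ‖y‖)) (hxy : B x y = M) :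
    B (x + y) (x + y) = M * ‖x + y‖ ^ 2 := by
  have h1 : ∀ z, B x z = M * inner ℂ y z :=
    eq_mul_inner_of_norm_le (B x) hy (fun z => by simpa [hx] using hle x z) hxy
  have h2 : ∀ z, B y z = M * inner ℂ x z :=
    eq_mul_inner_of_norm_le (B y) hx (fun z => by simpa [hy] using hle y z) (by rw [hB, hxy])
  rw [← Complex.coe_algebraMap, ← map_pow]
  have h3 : (inner ℂ (x + y) (x + y) : ℂ) = (algebraMap ℝ ℂ) (‖x + y‖) ^ 2 :=
    inner_self_eq_norm_sq_to_K (x + y)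
  rw [map_pow, ← h3, map_add, hB _ x, hB _ y, h1, h2, ← mul_add, ← inner_add_left, add_comm y x]
  rfl

/-- A bilinear form bounded by `M` on unit vectors has norm at most `M`. -/
theorem norm_bilin_le {E : Type*} [NormedAddCommGroup E] [NormedSpace ℂ E]
    (B : E →ₗ[ℂ] E →ₗ[ℂ] ℂ) {M : ℝ} (h : ∀ x y, ‖x‖ = 1 → ‖y‖ = 1 → ‖B x y‖ ≤ M) (x y : E) :
    ‖B x y‖ ≤ M * (‖x‖ * ‖y‖) := by
  rcases eq_or_ne x 0 with rfl | hx
  · simp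
  rcases eq_or_ne y 0 with rfl | hy
  · simp
  have hunit : ∀ z : E, z ≠ 0 → ‖((‖z‖ : ℂ)⁻¹) • z‖ = 1 := fun z hz => by
    rw [norm_smul, norm_inv, Complex.norm_real, norm_norm, inv_mul_cancel₀ (norm_ne_zero_iff.2 hz)]
  have h1 := h _ _ (hunit x hx) (hunit y hy)
  rw [LinearMap.map_smul₂, map_smul, smul_eq_mul, smul_eq_mul, norm_mul, norm_mul,
    norm_inv, norm_inv, Complex.norm_real, Complex.norm_real, norm_norm, norm_norm, ← mul_assoc,
    ← mul_inv, inv_mul_le_iff₀ (by positivity)] at h1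
  linarith

/-- If a symmetric multilinear form attains its maximum on tuples of unit vectors at `u`, then the
maximum is also attained after two entries of `u` are replaced by their normalized sum. -/
theorem norm_multilinear_update_update {E : Type*} [NormedAddCommGroup E] [InnerProductSpace ℂ E]
    [FiniteDimensional ℂ E] {m : ℕ} (L : MultilinearMap ℂ (fun _ : Fin m => E) ℂ)
    (hsymm : ∀ (σ : Equiv.Perm (Fin m)) v, L (v ∘ σ) = L v) {u : Fin m → E}
    (hu : ∀ i, ‖u i‖ = 1) (hmax : ∀ v : Fin m → E, (∀ i, ‖v i‖ = 1) → ‖L v‖ ≤ ‖L u‖)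
    {i j : Fin m} (hij : i ≠ j) (hne : u i + u j ≠ 0) {w : E}
    (hw : w = ((‖u i + u j‖ : ℂ)⁻¹) • (u i + u j)) :
    ‖L (Function.update (Function.update u i w) j w)‖ = ‖L u‖ := by
  -- Rotate `L` so that its value at `u` is real and nonnegative.
  obtain ⟨ζ, hζ, hLζ⟩ : ∃ ζ : ℂ, ‖ζ‖ = 1 ∧ ζ * L u = ‖L u‖ := by
    rcases eq_or_ne (L u) 0 with h | h
    · exact ⟨1, by simp, by simp [h]⟩
    · refine ⟨‖L u‖ / L u, ?_, div_mul_cancel₀ _ h⟩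
      rw [norm_div, Complex.norm_real, norm_norm, div_self (norm_ne_zero_iff.2 h)]
  let B : E →ₗ[ℂ] E →ₗ[ℂ] ℂ := LinearMap.mk₂ ℂ
    (fun a b => ζ * L (Function.update (Function.update u i a) j b))
    (fun a a' b => by
      simp only [Function.update_comm hij, MultilinearMap.map_update_add, mul_add])
    (fun c a b => by
      simp only [Function.update_comm hij, MultilinearMap.map_update_smul, smul_eq_mul]
      ring)
    (fun a b b' => by simp only [MultilinearMap.map_update_add, mul_add])
    (fun c a b => by
      simp only [MultilinearMap.map_update_smul, smul_eq_mul]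
      ring)
  have hBdef : ∀ a b, B a b = ζ * L (Function.update (Function.update u i a) j b) :=
    fun a b => rfl
  have hunit : ∀ a b, ‖a‖ = 1 → ‖b‖ = 1 →
      ∀ l, ‖Function.update (Function.update u i a) j b l‖ = 1 := fun a b ha hb l => by
    simp only [Function.update_apply]
    split_ifs
    exacts [hb, ha, hu l]
  have hBsymm : ∀ a b, B a b = B b a := fun a b => by
    rw [hBdef, hBdef, ← hsymm (Equiv.swap i j)]
    congr 2
    funext l
    simp only [Function.comp_apply, Function.update_apply, Equiv.swap_apply_def]
    by_cases hi : l = i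
    · simp [hi, hij]
    · by_cases hj : l = j
      · simp [hj, hij.symm, hij]
      · simp [hi, hj]
  have hBle : ∀ a b, ‖B a b‖ ≤ ‖L u‖ * (‖a‖ * ‖b‖) := norm_bilin_le B fun a b ha hb => by
    rw [hBdef, norm_mul, hζ, one_mul]
    exact hmax _ (hunit a b ha hb)
  have hBu : B (u i) (u j) = (‖L u‖ : ℝ) := by
    rw [hBdef, Function.update_eq_self, Function.update_eq_self, hLζ]
  have h := bilin_apply_add_self B hBsymm (hu i) (hu j) hBle hBu
  have hr : (‖u i + u j‖ : ℂ) ≠ 0 := by simpa using hne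
  have hBw : B w w = ‖L u‖ := by
    rw [hw, LinearMap.map_smul₂, map_smul, smul_eq_mul, smul_eq_mul, h]
    field_simp
  have h2 := congrArg norm hBw
  rwa [hBdef, norm_mul, hζ, one_mul, Complex.norm_real, norm_norm] at h2

/-- Banach's theorem: a symmetric multilinear form on a finite-dimensional complex Hilbert space
attains its norm on the diagonal. -/
theorem norm_multilinear_le_of_diagonal {E : Type*} [NormedAddCommGroup E] [InnerProductSpace ℂ E]
    [FiniteDimensional ℂ E] [Nontrivial E] {m : ℕ} (L : MultilinearMap ℂ (fun _ : Fin m => E) ℂ)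
    (hcont : Continuous L) (hsymm : ∀ (σ : Equiv.Perm (Fin m)) v, L (v ∘ σ) = L v) {C : ℝ}
    (hdiag : ∀ w : E, ‖w‖ = 1 → ‖L fun _ => w‖ ≤ C) {v : Fin m → E} (hv : ∀ i, ‖v i‖ = 1) :
    ‖L v‖ ≤ C := by
  rcases Nat.eq_zero_or_pos m with rfl | hm
  · obtain ⟨w, hw⟩ := exists_norm_eq E zero_le_one
    rw [Subsingleton.elim v fun _ => w]
    exact hdiag w hw
  have : Nonempty (Fin m) := ⟨⟨0, hm⟩⟩
  have : ProperSpace E := FiniteDimensional.proper ℂ E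
  have hK : IsCompact {x : Fin m → E | ∀ i, ‖x i‖ = 1} := by
    have h := isCompact_univ_pi fun _ : Fin m => isCompact_sphere (0 : E) 1
    convert h using 1
    ext x
    simp
  obtain ⟨x, hx, hxmax⟩ := hK.exists_isMaxOn ⟨v, hv⟩ hcont.norm.continuousOn
  have hxmax' : ∀ y : Fin m → E, (∀ i, ‖y i‖ = 1) → ‖L y‖ ≤ ‖L x‖ := fun y hy => hxmax hy
  -- A functional nonzero at every entry gives a way to compare maximizers.
  obtain ⟨f, hf⟩ := Module.exists_dual_forall_apply_ne_zero (K := ℂ) (v := x)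
    (fun i h => by simpa [h] using hx i)
  have hfc : Continuous f := LinearMap.continuous_of_finiteDimensional f
  obtain ⟨i₀, hi₀⟩ := Finite.exists_min fun i => ‖f (x i)‖
  set δ := ‖f (x i₀)‖ with hδ
  have hδ0 : 0 < δ := norm_pos_iff.2 (hf i₀)
  -- The bound `δ ≤ Re f` is a closed condition that rules out `y i + y j = 0` and survives
  -- averaging of two entries.
  set K : Set (Fin m → E) :=
    {y | (∀ i, ‖y i‖ = 1) ∧ ‖L y‖ = ‖L x‖ ∧ ∀ i, δ ≤ (f (y i)).re} with hKdef
  have hKc : IsCompact K := by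
    refine hK.inter_right (t := {y | ‖L y‖ = ‖L x‖ ∧ ∀ i, δ ≤ (f (y i)).re}) ?_
    refine (isClosed_eq hcont.norm continuous_const).inter ?_
    have : {y : Fin m → E | ∀ i, δ ≤ (f (y i)).re} = ⋂ i, {y | δ ≤ (f (y i)).re} := by
      ext
      simp
    change IsClosed {y : Fin m → E | ∀ i, δ ≤ (f (y i)).re}
    rw [this]
    exact isClosed_iInter fun i => isClosed_le continuous_const (by fun_prop)
  -- Rotating each entry by a phase makes `f (x i)` positive and leaves `‖L x‖` unchanged.
  have hKne : K.Nonempty := by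
    have hphase : ∀ i, ‖starRingEnd ℂ (f (x i)) / (‖f (x i)‖ : ℂ)‖ = 1 := fun i => by
      rw [norm_div, RCLike.norm_conj, Complex.norm_real, norm_norm,
        div_self (norm_ne_zero_iff.2 (hf i))]
    refine ⟨fun i => (starRingEnd ℂ (f (x i)) / (‖f (x i)‖ : ℂ)) • x i, fun i => ?_, ?_,
      fun i => ?_⟩
    · rw [norm_smul, hphase, hx, one_mul]
    · rw [MultilinearMap.map_smul_univ, norm_smul, norm_prod, Finset.prod_congr rfl
        fun i _ => hphase i, Finset.prod_const_one, one_mul]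
    · have h0 : (‖f (x i)‖ : ℂ) ≠ 0 := by simpa using hf i
      have : f ((starRingEnd ℂ (f (x i)) / (‖f (x i)‖ : ℂ)) • x i) = (‖f (x i)‖ : ℂ) := by
        rw [map_smul, smul_eq_mul, div_mul_eq_mul_div, Complex.conj_mul']
        field_simp
      rw [this, Complex.ofReal_re]
      exact hi₀ i
  obtain ⟨u, hu, humax⟩ := hKc.exists_isMaxOn hKne
    (f := fun y => ∑ i, (f (y i)).re) (by fun_prop)
  -- If two entries differ, their sum has norm below `2`, so replacing both by the normalized sum
  -- strictly increases `∑ Re f` within `K`.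
  have hconst : ∀ i j, u i = u j := by
    intro i j
    by_contra hne
    have hij : i ≠ j := fun h => hne (by rw [h])
    set r := (f (u i)).re + (f (u j)).re with hr
    have hrδ : 2 * δ ≤ r := by linarith [hu.2.2 i, hu.2.2 j]
    have hsum : u i + u j ≠ 0 := fun h => by
      have : (f (u i + u j)).re = r := by rw [map_add, Complex.add_re]
      rw [h, map_zero, Complex.zero_re] at this
      linarith
    have hs0 : 0 < ‖u i + u j‖ := norm_pos_iff.2 hsum
    have hs2 : ‖u i + u j‖ < 2 := by
      have h := parallelogram_law_with_norm ℂ (u i) (u j)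
      rw [hu.1, hu.1] at h
      have : 0 < ‖u i - u j‖ := norm_pos_iff.2 (sub_ne_zero.2 hne)
      nlinarith
    set w := ((‖u i + u j‖ : ℂ)⁻¹) • (u i + u j) with hw
    have hw1 : ‖w‖ = 1 := by
      rw [hw, norm_smul, norm_inv, Complex.norm_real, norm_norm, inv_mul_cancel₀ hs0.ne']
    have hfw : (f w).re = r / ‖u i + u j‖ := by
      rw [hw, map_smul, smul_eq_mul, ← Complex.ofReal_inv, Complex.re_ofReal_mul, map_add,
        Complex.add_re, ← hr]
      ring
    have hfw' : r < 2 * (f w).re := by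
      rw [hfw, ← mul_div_assoc, lt_div_iff₀ hs0]
      nlinarith
    set u' := Function.update (Function.update u i w) j w with hu'
    have hu'K : u' ∈ K := by
      refine ⟨fun l => ?_, ?_, fun l => ?_⟩
      · simp only [hu', Function.update_apply]
        split_ifs
        exacts [hw1, hw1, hu.1 l]
      · rw [hu', norm_multilinear_update_update L hsymm hu.1 (fun y hy => by
          rw [hu.2.1]; exact hxmax' y hy) hij hsum hw, hu.2.1]
      · simp only [hu', Function.update_apply]
        split_ifs
        exacts [by linarith, by linarith, hu.2.2 l]
    have hle : ∑ l, (f (u' l)).re ≤ ∑ l, (f (u l)).re := humax hu'K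
    have hdiff : ∑ l, ((f (u' l)).re - (f (u l)).re) =
        ((f w).re - (f (u i)).re) + ((f w).re - (f (u j)).re) := by
      rw [Finset.sum_eq_add i j hij]
      · simp [hu', hij]
      · intro l _ hl
        simp [hu', hl.1, hl.2]
      all_goals simp
    rw [Finset.sum_sub_distrib] at hdiff
    linarith
  have hueq : u = fun _ => u i₀ := funext fun i => hconst i i₀
  calc ‖L v‖ ≤ ‖L x‖ := hxmax' v hv
    _ = ‖L u‖ := hu.2.1.symm
    _ ≤ C := by
        rw [hueq]
        exact hdiag _ (hu.1 i₀)

/-! ### Homogeneous polynomials indexed by multisets, and the moment bound -/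

section

open Finset

/-- The sum of a tuple of multisets of size `m`, as a multiset of size `k * m`. -/
def symTotal {α : Type*} {k m : ℕ} (s : Fin k → Sym α m) : Sym α (k * m) :=
  ⟨∑ j, (s j : Multiset α), by simp [Multiset.card_sum]⟩

/-- The multiset of values of a tuple. -/
def symOfFn {α : Type*} {m : ℕ} (p : Fin m → α) : Sym α m :=
  ⟨univ.val.map p, by simp⟩

/-- The value at `v` of the monomial with multiset of variables `s`. -/
def symMonomial {ι : Type*} {m : ℕ} (v : ι → ℂ) (s : Sym ι m) : ℂ :=
  ((s : Multiset ι).map v).prod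

/-- The number of tuples with a given multiset of values. -/
def symCount {α : Type*} [Fintype α] [DecidableEq α] {m : ℕ} (s : Sym α m) : ℕ :=
  #{p : Fin m → α | symOfFn p = s}

theorem symMonomial_symTotal {ι : Type*} {k m : ℕ} (v : ι → ℂ) (s : Fin k → Sym ι m) :
    symMonomial v (symTotal s) = ∏ j, symMonomial v (s j) := by
  have h : ∀ t : Finset (Fin k), ((∑ j ∈ t, (s j : Multiset ι)).map v).prod =
      ∏ j ∈ t, ((s j : Multiset ι).map v).prod := fun t => by
    induction t using Finset.cons_induction with
    | empty => simp
    | cons a t ha ih => rw [sum_cons, prod_cons, Multiset.map_add, Multiset.prod_add, ih]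
  exact h univ

theorem symMonomial_symOfFn {ι : Type*} {m : ℕ} (v : ι → ℂ) (p : Fin m → ι) :
    symMonomial v (symOfFn p) = ∏ i, v (p i) := by
  change ((univ.val.map p).map v).prod = _
  rw [Multiset.map_map]
  rfl

theorem symOfFn_surjective {α : Type*} {m : ℕ} :
    Function.Surjective (symOfFn : (Fin m → α) → Sym α m) := by
  rintro ⟨s, hs⟩
  induction s using Quotient.inductionOn with
  | h l =>
    have hl : l.length = m := hs
    subst hl
    refine ⟨l.get, Subtype.ext ?_⟩
    change univ.val.map l.get = (l : Multiset α)
    rw [Fin.univ_val_map, List.ofFn_get]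

theorem symOfFn_comp_perm {α : Type*} {m : ℕ} (p : Fin m → α) (σ : Equiv.Perm (Fin m)) :
    symOfFn (p ∘ σ) = symOfFn p := by
  apply Subtype.ext
  change univ.val.map (p ∘ σ) = univ.val.map p
  rw [← Multiset.map_map, Multiset.map_univ_val_equiv]

theorem symCount_pos {α : Type*} [Fintype α] [DecidableEq α] {m : ℕ} (s : Sym α m) :
    0 < symCount s := by
  obtain ⟨p, hp⟩ := symOfFn_surjective s
  exact card_pos.2 ⟨p, by simpa using hp⟩

/-- Summation over tuples through their multisets of values. -/
theorem sum_comp_symOfFn {α M : Type*} [Fintype α] [DecidableEq α] [AddCommMonoid M] {m : ℕ}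
    (g : Sym α m → M) : ∑ p : Fin m → α, g (symOfFn p) = ∑ s : Sym α m, symCount s • g s := by
  rw [← sum_fiberwise univ symOfFn fun p => g (symOfFn p)]
  refine sum_congr rfl fun s _ => ?_
  rw [sum_congr rfl fun p hp => by rw [(mem_filter.1 hp).2], sum_const]
  rfl

/-- Multinomial theorem for `(∑ |v_i|²) ^ m`. -/
theorem sum_symCount_mul_norm_sq {ι : Type*} [Fintype ι] [DecidableEq ι] {m : ℕ} (v : ι → ℂ) :
    ∑ s : Sym ι m, (symCount s : ℝ) * ‖symMonomial v s‖ ^ 2 = (∑ i, ‖v i‖ ^ 2) ^ m := by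
  have h := sum_comp_symOfFn (m := m) fun s : Sym ι m => ‖symMonomial v s‖ ^ 2
  simp only [nsmul_eq_mul] at h
  rw [← h, Fintype.sum_pow]
  exact sum_congr rfl fun p _ => by rw [symMonomial_symOfFn, norm_prod, prod_pow]

/-- Cauchy-Schwarz with weights `C`, which may vanish where one of the factors does. -/
theorem norm_sum_mul_sq_le {β : Type*} [Fintype β] (C : β → ℝ) (hC : ∀ b, 0 ≤ C b) (x y : β → ℂ)
    (h0 : ∀ b, C b = 0 → x b = 0) :
    ‖∑ b, x b * y b‖ ^ 2 ≤ (∑ b, ‖x b‖ ^ 2 / C b) * ∑ b, C b * ‖y b‖ ^ 2 := by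
  calc ‖∑ b, x b * y b‖ ^ 2 ≤ (∑ b, (‖x b‖ / √(C b)) * (√(C b) * ‖y b‖)) ^ 2 := by
        gcongr
        refine norm_sum_le_of_le _ fun b _ => le_of_eq ?_
        rw [norm_mul]
        rcases eq_or_ne (C b) 0 with h | h
        · simp [h0 b h]
        · have : √(C b) ≠ 0 := (Real.sqrt_pos.2 ((hC b).lt_of_ne' h)).ne'
          field_simp
    _ ≤ (∑ b, (‖x b‖ / √(C b)) ^ 2) * ∑ b, (√(C b) * ‖y b‖) ^ 2 := sum_mul_sq_le_sq_mul_sq _ _ _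
    _ = _ := by simp_rw [div_pow, mul_pow, Real.sq_sqrt (hC _)]

/-- There are phases for which a homogeneous polynomial with coefficients of modulus
`√(symCount s)` is small on the whole unit sphere. -/
theorem exists_phases_norm_pow_le {ι : Type*} [Fintype ι] [DecidableEq ι] (m k : ℕ) :
    ∃ ε : Sym ι m → ℂ, (∀ s, ‖ε s‖ = 1) ∧ ∀ v : ι → ℂ, ∑ i, ‖v i‖ ^ 2 = 1 →
      (‖∑ s, ε s * √(symCount s : ℝ) * symMonomial v s‖ ^ 2) ^ k ≤
        k.factorial * Fintype.card (Sym ι (k * m)) := by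
  set S : Sym ι (k * m) → Finset (Fin k → Sym ι m) := fun b => {s | symTotal s = b} with hS
  set C : Sym ι (k * m) → ℝ := fun b => ∑ s ∈ S b, ∏ j, (symCount (s j) : ℝ) with hCdef
  have hprod : ∀ s : Fin k → Sym ι m, 0 < ∏ j, (symCount (s j) : ℝ) := fun s =>
    prod_pos fun j _ => by exact_mod_cast symCount_pos _
  have hC : ∀ b, 0 ≤ C b := fun b => sum_nonneg fun s _ => (hprod s).le
  set q : (Sym ι m → ZMod (k + 1)) → Sym ι (k * m) → ℂ := fun e b =>
    ∑ s ∈ S b, ∏ j, (ZMod.stdAddChar (e (s j)) * ((√(symCount (s j) : ℝ) : ℝ) : ℂ)) with hq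
  -- Covers the convention `x / 0 = 0`, so that no splitting of `b` need be exhibited.
  have hq0 : ∀ e b, C b = 0 → q e b = 0 := fun e b hb => by
    have : S b = ∅ := by
      by_contra hne
      exact (sum_pos (fun s _ => hprod s) (nonempty_iff_ne_empty.2 hne)).ne' hb
    simp [hq, this]
  have hpow : ∀ e (v : ι → ℂ),
      (∑ s : Sym ι m, ZMod.stdAddChar (e s) * √(symCount s : ℝ) * symMonomial v s) ^ k =
        ∑ b, q e b * symMonomial v b := fun e v => by
    rw [Fintype.sum_pow, ← sum_fiberwise univ symTotal]
    refine sum_congr rfl fun b _ => ?_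
    rw [hq, sum_mul]
    refine sum_congr rfl fun s hs => ?_
    rw [prod_mul_distrib, ← symMonomial_symTotal, (mem_filter.1 hs).2]
  have hweight : ∀ v : ι → ℂ, ∑ i, ‖v i‖ ^ 2 = 1 → ∑ b, C b * ‖symMonomial v b‖ ^ 2 = 1 :=
    fun v hv => by
      have h1 : ∑ s : Sym ι m, (symCount s : ℝ) * ‖symMonomial v s‖ ^ 2 = 1 := by
        rw [sum_symCount_mul_norm_sq, hv, one_pow]
      rw [← one_pow k, ← h1, Fintype.sum_pow, ← sum_fiberwise univ symTotal]
      refine sum_congr rfl fun b _ => ?_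
      rw [hCdef, sum_mul]
      refine sum_congr rfl fun s hs => ?_
      rw [prod_mul_distrib, prod_pow, ← norm_prod, ← symMonomial_symTotal, (mem_filter.1 hs).2]
  have havg : ∑ e : Sym ι m → ZMod (k + 1), ∑ b, ‖q e b‖ ^ 2 / C b ≤
      ∑ _e : Sym ι m → ZMod (k + 1), (k.factorial * Fintype.card (Sym ι (k * m)) : ℝ) := by
    rw [sum_comm, sum_const, card_univ, nsmul_eq_mul]
    calc _ ≤ ∑ _b : Sym ι (k * m), (Fintype.card (Sym ι m → ZMod (k + 1)) * k.factorial : ℝ) := by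
          refine sum_le_sum fun b _ => ?_
          rw [← sum_div]
          refine div_le_of_le_mul₀ (hC b) (by positivity) ?_
          have h := sum_norm_sq_phase_le k (S b) (fun s => √(symCount s : ℝ))
            fun s => Real.sqrt_nonneg _
          simp_rw [Real.sq_sqrt (Nat.cast_nonneg _)] at h
          rw [mul_assoc]
          exact h
      _ = _ := by
          rw [sum_const, card_univ, nsmul_eq_mul]
          ring
  -- The averaged quantity does not involve `v`, so one choice of phases serves all `v`.
  obtain ⟨e, -, he⟩ := exists_le_of_sum_le univ_nonempty havg
  refine ⟨fun s => ZMod.stdAddChar (e s), fun s => Circle.norm_coe _,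
    fun v hv => ?_⟩
  rw [← pow_mul, mul_comm 2 k, pow_mul, ← norm_pow, hpow]
  refine (norm_sum_mul_sq_le C hC (q e) (symMonomial v) (hq0 e)).trans ?_
  rw [hweight v hv, mul_one]
  exact he

end

/-! ### Asymptotics and the choice of the moment `k` -/

/-- The induction step is Bernoulli's inequality `(1 + 1/(k+1)) ^ (k+1) ≥ 2`. -/
theorem factorial_mul_two_pow_le (k : ℕ) : k.factorial * 2 ^ k ≤ (k + 1) ^ k := by
  induction k with
  | zero => simp
  | succ k ih =>
    have hB : 2 * (k + 1) ^ (k + 1) ≤ (k + 1 + 1) ^ (k + 1) := by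
      have h := one_add_mul_le_pow (a := (1 / ((k : ℝ) + 1))) (by
        have : (0 : ℝ) ≤ 1 / ((k : ℝ) + 1) := by positivity
        linarith) (k + 1)
      have hk : ((k : ℝ) + 1) ≠ 0 := by positivity
      have e1 : 1 + ((k + 1 : ℕ) : ℝ) * (1 / ((k : ℝ) + 1)) = 2 := by
        push_cast
        field_simp
        norm_num
      have e2 : 1 + 1 / ((k : ℝ) + 1) = ((k : ℝ) + 1 + 1) / (k + 1) := by
        field_simp
      rw [e1, e2, div_pow, le_div_iff₀ (by positivity)] at h
      exact_mod_cast h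
    calc (k + 1).factorial * 2 ^ (k + 1) = 2 * (k + 1) * (k.factorial * 2 ^ k) := by
          rw [Nat.factorial_succ]
          ring
      _ ≤ 2 * (k + 1) * (k + 1) ^ k := by gcongr
      _ = 2 * (k + 1) ^ (k + 1) := by ring
      _ ≤ _ := hB

/-- Since `k! ≤ ((k+1)/2) ^ k` and `e < 3`, the left side is at most `k ^ r * (3(k-1)/2) ^ k` for `k
≥ 21`; the remaining factor `(3/4) ^ k` absorbs `k ^ r`. -/
theorem eventually_factorial_mul_pow_mul_exp_le (r : ℕ) :
    ∀ᶠ k : ℕ in Filter.atTop,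
      (k.factorial : ℝ) * k ^ r * Real.exp k ≤ (2 * ((k : ℝ) - 1)) ^ k := by
  have ht := tendsto_pow_const_mul_const_pow_of_abs_lt_one r
    (show |(3 / 4 : ℝ)| < 1 by rw [abs_of_pos] <;> norm_num)
  filter_upwards [ht.eventually (ge_mem_nhds zero_lt_one), Filter.eventually_ge_atTop 21]
    with k hk h21
  have h21' : (21 : ℝ) ≤ k := by exact_mod_cast h21
  have hpow : (k : ℝ) ^ r * 3 ^ k ≤ 4 ^ k := by
    rw [div_pow, ← mul_div_assoc, div_le_one (by positivity)] at hk
    exact hk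
  have hfac : (k.factorial : ℝ) * 2 ^ k ≤ ((k : ℝ) + 1) ^ k := by
    exact_mod_cast factorial_mul_two_pow_le k
  have hexp : ((k : ℝ) + 1) ^ k * Real.exp k ≤ (3 * ((k : ℝ) - 1)) ^ k := by
    rw [← mul_one (k : ℝ), Real.exp_nat_mul, mul_one, ← mul_pow]
    -- `e (k + 1) ≤ 3 (k - 1)` needs `k ≥ 21`.
    refine pow_le_pow_left₀ (by positivity) ?_ k
    nlinarith [Real.exp_one_lt_d9]
  have h1 : (0 : ℝ) ≤ ((k : ℝ) - 1) ^ k := pow_nonneg (by linarith) k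
  have h2 : (k.factorial : ℝ) * k ^ r * Real.exp k * 2 ^ k ≤ (2 * ((k : ℝ) - 1)) ^ k * 2 ^ k := by
    calc (k.factorial : ℝ) * k ^ r * Real.exp k * 2 ^ k
        = (k.factorial : ℝ) * 2 ^ k * (k ^ r * Real.exp k) := by ring
      _ ≤ ((k : ℝ) + 1) ^ k * (k ^ r * Real.exp k) := by gcongr
      _ = k ^ r * (((k : ℝ) + 1) ^ k * Real.exp k) := by ring
      _ ≤ k ^ r * (3 * ((k : ℝ) - 1)) ^ k := by gcongr
      _ = (k ^ r * 3 ^ k) * ((k : ℝ) - 1) ^ k := by rw [mul_pow]; ring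
      _ ≤ 4 ^ k * ((k : ℝ) - 1) ^ k := by gcongr
      _ = _ := by rw [← mul_pow, ← mul_pow]; ring
  exact le_of_mul_le_mul_right h2 (by positivity)

namespace SymEntanglement

/-- `symDim (r + 1) M` is the product of the `r` factors `(M + i) / i`, and `k * m + i ≤ k * (m +
i)`. -/
theorem symDim_mul_le (r m : ℕ) {k : ℕ} (hk : 1 ≤ k) :
    symDim (r + 1) (k * m) ≤ k ^ r * symDim (r + 1) m := by
  have hdef : ∀ M, symDim (r + 1) M = (M + r).choose r := fun M => by
    rw [symDim, ← Nat.choose_symm_add]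
    rfl
  rw [hdef, hdef]
  induction r with
  | zero => simp
  | succ r ih =>
    have ih := ih fun M => by
      rw [symDim, ← Nat.choose_symm_add]
      rfl
    refine Nat.le_of_mul_le_mul_right (c := r + 1) ?_ r.succ_pos
    rw [← add_assoc, ← add_assoc, ← Nat.add_one_mul_choose_eq, mul_assoc,
      ← Nat.add_one_mul_choose_eq]
    calc (k * m + r + 1) * (k * m + r).choose r
        ≤ (k * (m + r + 1)) * (k ^ r * (m + r).choose r) := by
          refine Nat.mul_le_mul ?_ ih
          nlinarith
      _ = _ := by ring

theorem lt_symDim {n : ℕ} (hn : 2 ≤ n) (m : ℕ) : m < symDim n m := by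
  have h : (m + 1).choose m ≤ (m + n - 1).choose m := Nat.choose_le_choose m (by omega)
  rw [Nat.choose_succ_self_right] at h
  exact h

theorem eventually_exists_factorial_mul_symDim_le {n : ℕ} (hn : 2 ≤ n) :
    ∀ᶠ m : ℕ in Filter.atTop, ∃ k : ℕ, k ≠ 0 ∧
      (k.factorial * symDim n (k * m) : ℝ) ≤ (n * Real.log (symDim n m)) ^ k := by
  obtain ⟨r, rfl⟩ : ∃ r, n = r + 1 := ⟨n - 1, by omega⟩
  have hd : Filter.Tendsto (fun m => (symDim (r + 1) m : ℝ)) Filter.atTop Filter.atTop :=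
    tendsto_natCast_atTop_atTop.comp
      (Filter.tendsto_atTop_mono (fun m => (lt_symDim hn m).le) Filter.tendsto_id)
  have hk : Filter.Tendsto (fun m => ⌈Real.log (symDim (r + 1) m)⌉₊) Filter.atTop Filter.atTop :=
    tendsto_nat_ceil_atTop.comp (Real.tendsto_log_atTop.comp hd)
  filter_upwards [hk.eventually (eventually_factorial_mul_pow_mul_exp_le r),
    hk.eventually (Filter.eventually_ge_atTop 1)] with m hm h1
  set d : ℝ := (symDim (r + 1) m : ℝ) with hddef
  set k := ⌈Real.log d⌉₊ with hkdef
  have hd0 : 0 < d := by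
    rw [hddef]
    exact_mod_cast (Nat.zero_le m).trans_lt (lt_symDim hn m)
  have h1' : (1 : ℝ) ≤ k := by exact_mod_cast h1
  -- The natural ceiling of a negative number is `0`, contrary to `k ≥ 1`.
  have hlog : 0 ≤ Real.log d := by
    by_contra! h
    rw [Nat.ceil_eq_zero.2 h.le] at hkdef
    omega
  have hkd : (k : ℝ) - 1 ≤ Real.log d := by linarith [Nat.ceil_lt_add_one hlog]
  refine ⟨k, by omega, ?_⟩
  have hD : (symDim (r + 1) (k * m) : ℝ) ≤ k ^ r * d := by
    rw [hddef]
    exact_mod_cast symDim_mul_le r m h1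
  have hde : d ≤ Real.exp k := by
    rw [← Real.log_le_iff_le_exp hd0]
    exact Nat.le_ceil _
  have hn' : (2 : ℝ) ≤ (r + 1 : ℕ) := by exact_mod_cast hn
  calc (k.factorial * symDim (r + 1) (k * m) : ℝ) ≤ k.factorial * (k ^ r * Real.exp k) := by
        gcongr
        exact hD.trans (by gcongr)
    _ = k.factorial * k ^ r * Real.exp k := by ring
    _ ≤ (2 * ((k : ℝ) - 1)) ^ k := hm
    _ ≤ _ := by
        refine pow_le_pow_left₀ (by linarith) ?_ k
        exact mul_le_mul hn' hkd (by linarith) (by positivity)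

end SymEntanglement

/-! ### Symmetric tensors in coordinates; existence of the maximum -/

namespace SymEntanglement

open Finset

/-- The tensor with given coordinates. -/
noncomputable def ofCoords {n m : ℕ} (c : (Fin m → Fin n) → ℂ) : Tensor n m :=
  (stdBasis n m).equivFun.symm c

theorem stdBasis_repr_ofCoords {n m : ℕ} (c : (Fin m → Fin n) → ℂ) (p : Fin m → Fin n) :
    (stdBasis n m).repr (ofCoords c) p = c p := by
  rw [← Module.Basis.equivFun_apply, ofCoords, LinearEquiv.apply_symm_apply]

theorem ofCoords_repr {n m : ℕ} (T : Tensor n m) : ofCoords ((stdBasis n m).repr T) = T :=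
  (stdBasis n m).equivFun.symm_apply_apply T

theorem stdBasis_repr_reindex {n m : ℕ} (σ : Equiv.Perm (Fin m)) (T : Tensor n m)
    (p : Fin m → Fin n) :
    (stdBasis n m).repr
        (PiTensorProduct.reindex ℂ (fun _ : Fin m => EuclideanSpace ℂ (Fin n)) σ T) p =
      (stdBasis n m).repr T (p ∘ σ) := by
  induction T using PiTensorProduct.induction_on with
  | smul_tprod r v =>
    rw [map_smul, map_smul, map_smul, PiTensorProduct.reindex_tprod, Finsupp.smul_apply,
      Finsupp.smul_apply, stdBasis_repr_tprod, stdBasis_repr_tprod, ← Equiv.prod_comp σ]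
    exact congrArg (r • ·) (prod_congr rfl fun x _ => congrArg
      (fun y => (v y : EuclideanSpace ℂ (Fin n)) (p (σ x))) (σ.symm_apply_apply x))
  | add x y hx hy => rw [map_add, map_add, map_add, Finsupp.add_apply, hx, hy, Finsupp.add_apply]

theorem isSymmetric_iff {n m : ℕ} {T : Tensor n m} :
    IsSymmetric T ↔ ∀ (σ : Equiv.Perm (Fin m)) (p : Fin m → Fin n),
      (stdBasis n m).repr T (p ∘ σ) = (stdBasis n m).repr T p := by
  refine forall_congr' fun σ => ⟨fun h p => ?_, fun h => ?_⟩
  · rw [← stdBasis_repr_reindex, h]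
  · refine (stdBasis n m).repr.injective (Finsupp.ext fun p => ?_)
    rw [stdBasis_repr_reindex, h]

theorem tensorNorm_eq_one_iff {n m : ℕ} {T : Tensor n m} :
    tensorNorm T = 1 ↔ ∑ p, ‖(stdBasis n m).repr T p‖ ^ 2 = 1 := by
  rw [tensorNorm, Real.sqrt_eq_one, tensorInner]
  simp_rw [Complex.conj_mul', ← Complex.ofReal_pow, ← Complex.ofReal_sum, Complex.ofReal_re]

theorem tensorInner_tprod_right {n m : ℕ} (T : Tensor n m)
    (v : Fin m → EuclideanSpace ℂ (Fin n)) :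
    tensorInner T (PiTensorProduct.tprod ℂ v) =
      ∑ p : Fin m → Fin n, starRingEnd ℂ ((stdBasis n m).repr T p) * ∏ i, v i (p i) := by
  simp_rw [tensorInner, stdBasis_repr_tprod]

/-- The multilinear form `v ↦ ⟨T, v₁ ⊗ ⋯ ⊗ v_m⟩`. -/
noncomputable def innerForm {n m : ℕ} (T : Tensor n m) :
    MultilinearMap ℂ (fun _ : Fin m => EuclideanSpace ℂ (Fin n)) ℂ :=
  (∑ p : Fin m → Fin n, starRingEnd ℂ ((stdBasis n m).repr T p) •
    (stdBasis n m).coord p).compMultilinearMap (PiTensorProduct.tprod ℂ)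

theorem innerForm_apply {n m : ℕ} (T : Tensor n m) (v : Fin m → EuclideanSpace ℂ (Fin n)) :
    innerForm T v = tensorInner T (PiTensorProduct.tprod ℂ v) := by
  simp [innerForm, tensorInner]

theorem continuous_innerForm {n m : ℕ} (T : Tensor n m) : Continuous (innerForm T) := by
  simp_rw [funext (innerForm_apply T), tensorInner_tprod_right]
  fun_prop

theorem IsSymmetric.innerForm_comp_perm {n m : ℕ} {T : Tensor n m} (hT : IsSymmetric T)
    (σ : Equiv.Perm (Fin m)) (v : Fin m → EuclideanSpace ℂ (Fin n)) :
    innerForm T (v ∘ σ) = innerForm T v := by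
  rw [innerForm_apply, innerForm_apply, tensorInner_tprod_right, tensorInner_tprod_right,
    ← Equiv.sum_comp (Equiv.arrowCongr σ.symm (Equiv.refl (Fin n)))]
  refine sum_congr rfl fun p _ => ?_
  have h1 : (Equiv.arrowCongr σ.symm (Equiv.refl (Fin n))) p = p ∘ σ := by
    ext
    simp
  rw [h1, isSymmetric_iff.1 hT]
  congr 1
  exact Equiv.prod_comp σ fun i => v i (p i)

theorem norm_tensorInner_le_spectralNorm {n m : ℕ} (hn : 1 ≤ n) (T : Tensor n m)
    {v : Fin m → EuclideanSpace ℂ (Fin n)} (hv : ∀ i, ‖v i‖ = 1) :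
    ‖tensorInner T (PiTensorProduct.tprod ℂ v)‖ ≤ spectralNorm T :=
  (isGreatest_spectralNorm hn T).2
    ⟨_, ⟨v, rfl⟩, by rw [tensorNorm_tprod]; exact prod_eq_one fun i _ => hv i, rfl⟩

/-- The spectral norm of a symmetric tensor is bounded by its values on powers of unit vectors. -/
theorem IsSymmetric.spectralNorm_le {n m : ℕ} (hn : 1 ≤ n) {T : Tensor n m} (hT : IsSymmetric T)
    {C : ℝ} (hC : ∀ w : EuclideanSpace ℂ (Fin n), ‖w‖ = 1 →
      ‖tensorInner T (PiTensorProduct.tprod ℂ fun _ => w)‖ ≤ C) : spectralNorm T ≤ C := by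
  have : Nonempty (Fin n) := ⟨⟨0, hn⟩⟩
  obtain ⟨u, hu, h1, h⟩ := (isGreatest_spectralNorm hn T).1
  obtain ⟨v, hv, rfl⟩ := exists_unit_factors hu h1
  rw [h, ← innerForm_apply]
  exact norm_multilinear_le_of_diagonal _ (continuous_innerForm T) hT.innerForm_comp_perm
    (fun w hw => by rw [innerForm_apply]; exact hC w hw) hv

/-- Pairing with a basis tensor detects a nonzero coordinate. Positivity is what makes the logarithm
in the entanglement monotone. -/
theorem spectralNorm_pos {n m : ℕ} (hn : 1 ≤ n) {T : Tensor n m} (hT : tensorNorm T = 1) :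
    0 < spectralNorm T := by
  rw [tensorNorm_eq_one_iff] at hT
  obtain ⟨p, -, hp⟩ : ∃ p ∈ univ, ‖(stdBasis n m).repr T p‖ ^ 2 ≠ 0 :=
    exists_ne_zero_of_sum_ne_zero (by rw [hT]; exact one_ne_zero)
  refine lt_of_lt_of_le ?_ (norm_tensorInner_le_spectralNorm hn T
    (v := fun i => EuclideanSpace.single (p i) 1) fun i => by simp)
  have h : tensorInner T (PiTensorProduct.tprod ℂ fun i => EuclideanSpace.single (p i) (1 : ℂ)) =
      starRingEnd ℂ ((stdBasis n m).repr T p) := by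
    rw [tensorInner_tprod_right, sum_eq_single p]
    · simp
    · intro q _ hq
      obtain ⟨i, hi⟩ := Function.ne_iff.1 hq
      rw [prod_eq_zero (mem_univ i) (by simp [hi]), mul_zero]
    · simp
  rw [h, RCLike.norm_conj]
  exact (norm_nonneg _).lt_of_ne fun h => hp (by rw [← h]; norm_num)

/-- A supremum of a jointly continuous function over a fixed compact set is continuous in the
parameter. -/
theorem continuous_spectralNorm_ofCoords (n m : ℕ) :
    Continuous fun c : (Fin m → Fin n) → ℂ => spectralNorm (ofCoords c) := by
  have hK : IsCompact (Set.univ.pi fun _ : Fin m =>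
      Metric.sphere (0 : EuclideanSpace ℂ (Fin n)) 1) :=
    isCompact_univ_pi fun _ => isCompact_sphere 0 1
  let f : ((Fin m → Fin n) → ℂ) → (Fin m → EuclideanSpace ℂ (Fin n)) → ℝ := fun c v =>
    ‖∑ p, starRingEnd ℂ (c p) * ∏ i, v i (p i)‖
  have hf : Continuous (Function.HasUncurry.uncurry f) := by
    change Continuous fun x : ((Fin m → Fin n) → ℂ) × (Fin m → EuclideanSpace ℂ (Fin n)) =>
      ‖∑ p, starRingEnd ℂ (x.1 p) * ∏ i, x.2 i (p i)‖
    fun_prop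
  convert hK.continuous_sSup hf using 2 with c
  rw [spectralNorm]
  congr 1
  ext x
  constructor
  · rintro ⟨u, hu, h1, rfl⟩
    obtain ⟨v, hv, rfl⟩ := exists_unit_factors hu h1
    refine ⟨v, fun i _ => by simp [hv i], ?_⟩
    simp only [f, tensorInner_tprod_right, stdBasis_repr_ofCoords]
  · rintro ⟨v, hv, rfl⟩
    refine ⟨_, ⟨v, rfl⟩, ?_, ?_⟩
    · rw [tensorNorm_tprod]
      exact prod_eq_one fun i _ => by simpa using hv i (Set.mem_univ i)
    · simp only [f, tensorInner_tprod_right, stdBasis_repr_ofCoords]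

theorem isCompact_unitSymmetric_coords (n m : ℕ) :
    IsCompact {c : (Fin m → Fin n) → ℂ | ofCoords c ∈ unitSymmetric n m} := by
  have hset : {c : (Fin m → Fin n) → ℂ | ofCoords c ∈ unitSymmetric n m} =
      (⋂ (σ : Equiv.Perm (Fin m)) (p : Fin m → Fin n), {c | c (p ∘ σ) = c p}) ∩
        {c | ∑ p, ‖c p‖ ^ 2 = 1} := by
    ext c
    simp [unitSymmetric, isSymmetric_iff, tensorNorm_eq_one_iff, stdBasis_repr_ofCoords]
  rw [hset]
  refine Metric.isCompact_of_isClosed_isBounded ?_ ?_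
  · exact (isClosed_iInter fun σ => isClosed_iInter fun p =>
      isClosed_eq (by fun_prop) (by fun_prop)).inter (isClosed_eq (by fun_prop) (by fun_prop))
  · refine (Metric.isBounded_closedBall (x := (0 : (Fin m → Fin n) → ℂ)) (r := 1)).subset ?_
    rintro c ⟨-, hc⟩
    rw [mem_closedBall_zero_iff, pi_norm_le_iff_of_nonneg zero_le_one]
    intro p
    have h : ‖c p‖ ^ 2 ≤ 1 := le_trans
      (single_le_sum (f := fun p => ‖c p‖ ^ 2) (fun p _ => sq_nonneg _) (mem_univ p)) (le_of_eq hc)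
    exact (sq_le_one_iff₀ (norm_nonneg _)).1 h

theorem isGreatest_maxSymEntanglement {n m : ℕ} (hn : 1 ≤ n) (hne : (unitSymmetric n m).Nonempty) :
    IsGreatest (entanglement '' unitSymmetric n m) (maxSymEntanglement n m) := by
  obtain ⟨T₀, hT₀⟩ := hne
  obtain ⟨c, hc, hmin⟩ := (isCompact_unitSymmetric_coords n m).exists_isMinOn
    ⟨(stdBasis n m).repr T₀, by
      change ofCoords ((stdBasis n m).repr T₀) ∈ unitSymmetric n m
      rwa [ofCoords_repr]⟩
    (continuous_spectralNorm_ofCoords n m).continuousOn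
  have hgr : IsGreatest (entanglement '' unitSymmetric n m) (entanglement (ofCoords c)) := by
    refine ⟨⟨_, hc, rfl⟩, ?_⟩
    rintro _ ⟨T, hT, rfl⟩
    have hle : spectralNorm (ofCoords c) ≤ spectralNorm T := by
      have h : ofCoords ((stdBasis n m).repr T) ∈ unitSymmetric n m := by rwa [ofCoords_repr]
      have h' := hmin h
      simpa [ofCoords_repr] using h'
    have h := Real.logb_le_logb_of_le one_lt_two (spectralNorm_pos hn hc.2) hle
    simp only [entanglement]
    linarith
  rw [maxSymEntanglement, hgr.csSup_eq]
  exact hgr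

/-! ### The random symmetric tensor and the lower bound -/

theorem card_sym_fin (n m : ℕ) : Fintype.card (Sym (Fin n) m) = symDim n m := by
  rw [Sym.card_sym_eq_choose, Fintype.card_fin, symDim, add_comm]

/-- Moment bound for the smallest spectral norm of a symmetric unit tensor. -/
theorem exists_unitSymmetric_spectralNorm_sq_le {n : ℕ} (hn : 1 ≤ n) (m : ℕ) {k : ℕ} (hk : k ≠ 0)
    {B : ℝ} (hB : 0 ≤ B) (h : (k.factorial * symDim n (k * m) : ℝ) ≤ (symDim n m * B) ^ k) :
    ∃ T ∈ unitSymmetric n m, spectralNorm T ^ 2 ≤ B := by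
  obtain ⟨ε, hε, hbound⟩ := exists_phases_norm_pow_le (ι := Fin n) m k
  rw [card_sym_fin] at hbound
  set d : ℝ := (symDim n m : ℝ) with hd
  have hd0 : 0 < d := by
    rw [hd, symDim]
    exact_mod_cast Nat.choose_pos (by omega)
  have hc0 : ∀ s : Sym (Fin n) m, (0 : ℝ) < symCount s := fun s => by
    exact_mod_cast symCount_pos s
  -- Each multiset class has `symCount` equal coordinates in modulus and total mass `1 / d`. The
  -- phase is conjugated because the form is antilinear in `T`.
  set T : Tensor n m := ofCoords fun p => starRingEnd ℂ (ε (symOfFn p)) *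
    ((√(d * symCount (symOfFn p)))⁻¹ : ℝ) with hT
  have hsymm : IsSymmetric T := isSymmetric_iff.2 fun σ p => by
    simp only [hT, stdBasis_repr_ofCoords, symOfFn_comp_perm]
  have hunit : tensorNorm T = 1 := by
    rw [tensorNorm_eq_one_iff]
    simp only [hT, stdBasis_repr_ofCoords, norm_mul, RCLike.norm_conj, hε, one_mul,
      Complex.norm_real, norm_inv, Real.norm_of_nonneg (Real.sqrt_nonneg _), inv_pow]
    have hsq : ∀ s : Sym (Fin n) m, √(d * symCount s) ^ 2 = d * symCount s := fun s =>
      Real.sq_sqrt (mul_pos hd0 (hc0 s)).le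
    simp only [hsq]
    rw [sum_comp_symOfFn fun s : Sym (Fin n) m => (d * symCount s : ℝ)⁻¹]
    have : ∀ s : Sym (Fin n) m, symCount s • (d * symCount s : ℝ)⁻¹ = d⁻¹ := fun s => by
      have := (hc0 s).ne'
      rw [nsmul_eq_mul]
      field_simp
    simp only [this, sum_const, card_univ, card_sym_fin, nsmul_eq_mul]
    exact mul_inv_cancel₀ hd0.ne'
  refine ⟨T, ⟨hsymm, hunit⟩, ?_⟩
  have hle : spectralNorm T ≤ √B := hsymm.spectralNorm_le hn fun w hw => by
    refine Real.le_sqrt_of_sq_le ?_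
    have hval : tensorInner T (PiTensorProduct.tprod ℂ fun _ => w) =
        ((√d)⁻¹ : ℝ) * ∑ s, ε s * √(symCount s : ℝ) * symMonomial w s := by
      rw [tensorInner_tprod_right]
      simp only [hT, stdBasis_repr_ofCoords, map_mul, Complex.conj_conj, Complex.conj_ofReal,
        ← symMonomial_symOfFn]
      rw [sum_comp_symOfFn fun s : Sym (Fin n) m =>
        ε s * ((√(d * symCount s))⁻¹ : ℝ) * symMonomial w s, mul_sum]
      refine sum_congr rfl fun s _ => ?_
      have h1 : (symCount s : ℝ) * (√(d * symCount s))⁻¹ = (√d)⁻¹ * √(symCount s : ℝ) := by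
        have h2 : √(symCount s : ℝ) ≠ 0 := (Real.sqrt_pos.2 (hc0 s)).ne'
        have h3 : √d ≠ 0 := (Real.sqrt_pos.2 hd0).ne'
        rw [Real.sqrt_mul hd0.le]
        field_simp
        rw [Real.sq_sqrt (hc0 s).le]
      have h1' := congrArg (fun x : ℝ => (x : ℂ)) h1
      simp only [Complex.ofReal_mul, Complex.ofReal_natCast] at h1'
      rw [nsmul_eq_mul]
      linear_combination ε s * symMonomial w s * h1'
    have hw' : ∑ i, ‖w i‖ ^ 2 = 1 := by rw [← EuclideanSpace.norm_sq_eq, hw, one_pow]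
    have hb := (hbound w hw').trans h
    have hb' := (pow_le_pow_iff_left₀ (by positivity) (by positivity) hk).1 hb
    rw [hval, norm_mul, Complex.norm_real, norm_inv, Real.norm_of_nonneg (Real.sqrt_nonneg _),
      mul_pow, inv_pow, Real.sq_sqrt hd0.le, inv_mul_le_iff₀ hd0]
    exact hb'
  calc spectralNorm T ^ 2 ≤ √B ^ 2 := pow_le_pow_left₀ (spectralNorm_pos hn hunit).le hle 2
    _ = B := Real.sq_sqrt hB

theorem unitSymmetric_nonempty {n : ℕ} (hn : 1 ≤ n) (m : ℕ) : (unitSymmetric n m).Nonempty := by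
  refine ⟨PiTensorProduct.tprod ℂ fun _ => EuclideanSpace.single ⟨0, hn⟩ 1, fun σ => ?_, ?_⟩
  · rw [PiTensorProduct.reindex_tprod]
  · rw [tensorNorm_tprod]
    simp

end SymEntanglement

theorem corollary1p9 (n : ℕ) (hn : 2 ≤ n) :
    (∀ m : ℕ, IsGreatest (SymEntanglement.entanglement '' SymEntanglement.unitSymmetric n m)
        (SymEntanglement.maxSymEntanglement n m)) ∧
    ∀ᶠ m : ℕ in Filter.atTop,
      Real.logb 2 (SymEntanglement.symDim n m) - Real.logb 2 (Real.log (SymEntanglement.symDim n m))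
          - Real.logb 2 n ≤
        SymEntanglement.maxSymEntanglement n m := by
  have hn1 : 1 ≤ n := one_le_two.trans hn
  have hmax : ∀ m : ℕ,
      IsGreatest (SymEntanglement.entanglement '' SymEntanglement.unitSymmetric n m)
        (SymEntanglement.maxSymEntanglement n m) := fun m =>
    SymEntanglement.isGreatest_maxSymEntanglement hn1
      (SymEntanglement.unitSymmetric_nonempty hn1 m)
  refine ⟨hmax, ?_⟩
  filter_upwards [SymEntanglement.eventually_exists_factorial_mul_symDim_le hn,
    Filter.eventually_ge_atTop 1] with m ⟨k, hk, hle⟩ hm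
  set d : ℝ := (SymEntanglement.symDim n m : ℝ) with hd
  have hd1 : 1 < d := by
    rw [hd]
    exact_mod_cast hm.trans_lt (SymEntanglement.lt_symDim hn m)
  have hd0 : 0 < d := one_pos.trans hd1
  have hlog : 0 < Real.log d := Real.log_pos hd1
  have hn0 : (0 : ℝ) < n := by exact_mod_cast hn1
  -- This `B` turns `d * B` into `n ln d`, the base in the bound for `k`.
  obtain ⟨T, hT, hTB⟩ := SymEntanglement.exists_unitSymmetric_spectralNorm_sq_le hn1 m hk
    (B := n * Real.log d / d) (by positivity) (by rwa [← hd, mul_div_cancel₀ _ hd0.ne'])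
  have hpos := SymEntanglement.spectralNorm_pos hn1 hT.2
  have h1 := Real.logb_le_logb_of_le one_lt_two (pow_pos hpos 2) hTB
  rw [Real.logb_pow, Real.logb_div (by positivity) hd0.ne', Real.logb_mul hn0.ne' hlog.ne'] at h1
  have h2 : SymEntanglement.entanglement T ≤ SymEntanglement.maxSymEntanglement n m :=
    (hmax m).2 ⟨T, hT, rfl⟩
  rw [SymEntanglement.entanglement] at h2
  push_cast at h1
  linarith
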